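/- Let $d\ge 1$, let $\|\cdot\|$ be any norm on $\mathbb R^d$ and let $B(x,\delta)$ denote its balls. Let $f,g$ be probability densities on $\mathbb R^d$ with respect to Lebesgue measure. Put $$\mu=\frac{f+g}{2},\qquad \eta=\frac{g}{f+g}\ \text{ on } \{\mu>0\}.$$ In the smooth discriminant analysis (binomial sample-size) model one observes two independent i.i.d. samples $X_1,\dots,X_n\sim f$ (label $0$) and $\tilde X_1,\dots,\tilde X_n\sim g$ (label $1$). For a sample-dependent classifier $\Phi_n:\mathbb R^d\to\{0,1\}$ the risk is $$\mathcal R(\Phi_n)=\mathbb E\Big[\tfrac12\Big(\int_{\{\Phi_n=1\}}f(x)\,dx+\int_{\{\Phi_n=0\}}g(x)\,dx\Big)\Big],$$ the expectation being over the two samples, and $\Phi^*=\mathbf 1_{\{\eta\ge 1/2\}}$ is the Bayes classifier. The $k$-nearest neighbour rule is $\Phi_{n,k}(x)=\mathbf 1\{\frac1k\sum_{j=1}^k \mathcal Y_{(j)}(x)>\frac12\}$, where $\mathcal Y_{(1)}(x),\dots,\mathcal Y_{(2n)}(x)$ are the labels of the $2n$ aggregated points, reordered by increasing distance to $x$. Fix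 a set $\Omega\subset\mathbb R^d$ and constants $L, C$, $\alpha>0$, $\kappa>0$, $\mu_->0$, and let $\mathcal F$ be the set of all pairs $(f,g)$ with $\{\mu>0\}=\Omega$ such that * (smoothness) $|\eta(x_1)-\eta(x_2)|\le L\|x_1-x_2\|$ for all $x_1,x_2\in\Omega$; * (margin) $\int_{\{0<|\eta-1/2|<\varepsilon\}}(f+g)\,dx\le C\varepsilon^{\alpha}$ for all $\varepsilon>0$; * (minimal mass) there is $\delta_0>0$ such that $\int_{B(x,\delta)}\mu\ge\kappa\,\mu(x)\,\delta^d$ for all $0<\delta\le\delta_0$ and all $x\in\Omega$; * (lower bound) $\mu(x)\ge\mu_-$ for all $x\in\Omega$. Then there is a constant $K>0$, depending only on $d,\|\cdot\|,\Omega,L,C,\alpha,\kappa,\mu_-$, such that for all $n\ge 2$, with $k_n=\lfloor n^{2/(2+d)}\rfloor$, $$\sup_{(f,g)\in\mathcal F}\big[\mathcal R(\Phi_{n,k_n})-\mathcal R(\Phi^*)\big]\le K\,\log(n)\,n^{-\frac{1+\alpha}{2+d}} \quad\text{and}\quad \sup_{(f,g)\in\mathcal F}\big[\mathcal R(\Phi_{n,k_n})-\mathcal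 R(\Phi^*)\big]\le K\Big(\frac{\log n}{n}\Big)^{\frac{1+\alpha}{2+d}}.$$ -/

import Mathlib

open MeasureTheory

noncomputable section

namespace SmoothDA

variable {E : Type*} [NormedAddCommGroup E] [NormedSpace ℝ E] [MeasurableSpace E]

/-- `f` is a probability density with respect to the measure `lam`. -/
structure IsDensity (lam : Measure E) (f : E → ℝ) : Prop where
  measurable : Measurable f
  nonneg : ∀ x, 0 ≤ f x
  lintegral_eq_one : ∫⁻ x, ENNReal.ofReal (f x) ∂lam = 1

/-- The law with density `f`. -/
def law (lam : Measure E) (f : E → ℝ) : Measure E :=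
  lam.withDensity fun x => ENNReal.ofReal (f x)

/-- The marginal density `(f + g) / 2` of a new observation `X`. -/
def marginal (f g : E → ℝ) (x : E) : ℝ := (f x + g x) / 2

/-- The regression function `η = g / (f + g)`: the probability, given `X = x`, that `X` comes from
`g` (label `1`). It is meaningful on `{f + g > 0}`; the value outside is never used. -/
def regression (f g : E → ℝ) (x : E) : ℝ := g x / (f x + g x)

/-- The Bayes classifier. -/
def bayes (f g : E → ℝ) (x : E) : Fin 2 := if 1 / 2 ≤ regression f g x then 1 else 0

/-- The risk of a decision rule `φ`: the probability of a wrong label, when the label of the new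
observation is `0` or `1` with probability `1 / 2` each, and the observation is then drawn from `f`
or from `g` respectively. -/
def risk (lam : Measure E) (f g : E → ℝ) (φ : E → Fin 2) : ℝ :=
  1 / 2 * ((∫ x in {x | φ x = 1}, f x ∂lam) + ∫ x in {x | φ x = 0}, g x ∂lam)

/-- The `k`-nearest neighbour rule built on the points `p i` with labels `y i`, `i < m`.
`Tuple.sort` is the permutation that reorders the points by increasing distance to `x` (ties are
broken by the index), so that `p (σ 0), p (σ 1), …` are the successive neighbours of `x`. -/
def knn {m : ℕ} (p : Fin m → E) (y : Fin m → Fin 2) (k : ℕ) (x : E) : Fin 2 :=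
  let σ : Equiv.Perm (Fin m) := Tuple.sort fun i => ‖p i - x‖
  if 1 / 2 < (1 / (k : ℝ)) * ∑ j : Fin m with j.val < k, (((y (σ j)).val : ℕ) : ℝ) then 1 else 0

/-- The `k`-nearest neighbour rule on the two aggregated samples: the points of the first sample
have label `0`, those of the second have label `1`. -/
def knnSDA {n : ℕ} (k : ℕ) (S : (Fin n → E) × (Fin n → E)) : E → Fin 2 :=
  knn (Fin.append S.1 S.2) (Fin.append (fun _ => 0) (fun _ => 1)) k

/-- The joint law of two independent samples, each of size `n` and i.i.d., with respective
densities `f` and `g`. -/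
def sampleLaw (lam : Measure E) (f g : E → ℝ) (n : ℕ) :
    Measure ((Fin n → E) × (Fin n → E)) :=
  (Measure.pi fun _ : Fin n => law lam f).prod (Measure.pi fun _ : Fin n => law lam g)

/-- Smoothness: `η` is `L`-Lipschitz on `Ω`. -/
def Smooth (Ω : Set E) (L : ℝ) (η : E → ℝ) : Prop :=
  ∀ x₁ ∈ Ω, ∀ x₂ ∈ Ω, |η x₁ - η x₂| ≤ L * ‖x₁ - x₂‖

/-- The margin assumption with exponent `α` and constant `C`. -/
def Margin (lam : Measure E) (f g : E → ℝ) (α C : ℝ) : Prop :=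
  ∀ ε : ℝ, 0 < ε →
    ∫ x in {x | 0 < |regression f g x - 1 / 2| ∧ |regression f g x - 1 / 2| < ε},
      (f x + g x) ∂lam ≤ C * ε ^ α

/-- The strong minimal mass assumption for the density `μ` on `Ω`. -/
def MinimalMass (lam : Measure E) (Ω : Set E) (κ : ℝ) (μ : E → ℝ) : Prop :=
  ∃ δ₀ : ℝ, 0 < δ₀ ∧ ∀ δ : ℝ, 0 < δ → δ ≤ δ₀ → ∀ x ∈ Ω,
    κ * μ x * δ ^ Module.finrank ℝ E ≤ ∫ z in Metric.ball x δ, μ z ∂lam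

/-- The class of pairs of densities over which the nearest neighbour rule is studied. -/
structure InClass (lam : Measure E) (Ω : Set E) (L α C κ μmin : ℝ) (f g : E → ℝ) : Prop where
  density_left : IsDensity lam f
  density_right : IsDensity lam g
  support_eq : {x | 0 < marginal f g x} = Ω
  smooth : Smooth Ω L (regression f g)
  margin : Margin lam f g α C
  minimalMass : MinimalMass lam Ω κ (marginal f g)
  lower_bound : ∀ x ∈ Ω, μmin ≤ marginal f g x

/-- The risk of the `k`-nearest neighbour rule in the smooth discriminant analysis model: the
expectation over the two samples of the risk of the resulting decision rule. -/
def knnRisk (lam : Measure E) (f g : E → ℝ) (n k : ℕ) : ℝ :=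
  ∫ S, risk lam f g (knnSDA k S) ∂(sampleLaw lam f g n)

end SmoothDA

end

/-! The excess risk is the integral of `D * (f + g)`, with `D = |η - 1/2|`, against the probability
that the rule disagrees with Bayes at `x` (`knnRisk_sub_risk_bayes`). The law of the `k`-th
neighbour distance is never studied. Instead one fixes a deterministic radius whose ball has
expected count `k * (1 - D / 8)`. With large probability this ball holds at most `k` points, so all
of them are among the `k` neighbours, and if `η` varies by at most `D / 2` on it, more than `k / 2`
of them carry the Bayes label. Two Chernoff bounds then bound the error probability by `2 * exp (-(k
* D ^ 2 / 256))` (`measureReal_knnSDA_ne_bayes_le`).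

A ball of radius of order `n ^ (-1 / (2 + d))` has mass at least `k / n`, and by the Lipschitz
condition `η` is nearly constant there as soon as `D` exceeds a multiple `ε` of this same quantity.
Peeling over dyadic levels of `D / ε` with the margin condition (`integral_peeling_le`) gives order
`ε ^ (1 + α)`, with no logarithm; both stated bounds are weaker.

Uniformity over the class needs an argument, because the range of radii in the minimal mass
condition depends on the pair. `exists_uniform_mass` transfers this condition from one reference
pair to all others. -/

noncomputable section

namespace SmoothDA

/-! ### Deterministic criteria for the output of the rule, from counts in a ball. -/

section Combinatorics

variable {E : Type*} [NormedAddCommGroup E]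

/-- If a ball around `x` holds at most `k` of the points, then all of these are among the first `k`
neighbours of `x`. -/
theorem sort_symm_lt_of_card_le {m : ℕ} (p : Fin m → E) (x : E) (s : ℝ) (k : ℕ)
    (hN : (Finset.univ.filter fun i => ‖p i - x‖ < s).card ≤ k) (i : Fin m)
    (hi : ‖p i - x‖ < s) :
    ((Tuple.sort fun i => ‖p i - x‖).symm i).val < k := by
  set σ := Tuple.sort fun i => ‖p i - x‖ with hσ
  by_contra! hk
  have hmono : Monotone ((fun i => ‖p i - x‖) ∘ σ) := Tuple.monotone_sort _
  -- Every point ranked no later than `i` is at least as close, hence in the ball. There are rank +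
  -- 1 of them, since ranks start at `0`, which is why `≤ k` yields a strict inequality for the
  -- rank.
  have hsub : (Finset.Iic (σ.symm i)).map σ.toEmbedding ⊆
      Finset.univ.filter fun i => ‖p i - x‖ < s := by
    intro a ha
    simp only [Finset.mem_map, Finset.mem_Iic, Equiv.coe_toEmbedding] at ha
    obtain ⟨j, hj, rfl⟩ := ha
    have := hmono hj
    simp only [Function.comp_apply, Equiv.apply_symm_apply] at this
    simp only [Finset.mem_filter, Finset.mem_univ, true_and]
    exact this.trans_lt hi
  have := Finset.card_le_card hsub
  rw [Finset.card_map, Fin.card_Iic] at this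
  omega

/-- The points with a given label in a ball that holds at most `k` points are counted by the first
`k` neighbours. -/
theorem card_label_le {m : ℕ} (p : Fin m → E) (y : Fin m → Fin 2) (x : E) (s : ℝ) (k : ℕ)
    (hN : (Finset.univ.filter fun i => ‖p i - x‖ < s).card ≤ k) (b : Fin 2) :
    (Finset.univ.filter fun i => ‖p i - x‖ < s ∧ y i = b).card ≤
      (Finset.univ.filter fun j : Fin m =>
        j.val < k ∧ y ((Tuple.sort fun i => ‖p i - x‖) j) = b).card := by
  refine Finset.card_le_card_of_injOn (Tuple.sort fun i => ‖p i - x‖).symm ?_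
    (Equiv.injective _).injOn
  intro i hi
  simp only [Finset.coe_filter, Finset.mem_univ, true_and, Set.mem_ofPred_eq] at hi ⊢
  exact ⟨sort_symm_lt_of_card_le p x s k hN i hi.1, by simpa using hi.2⟩

theorem sum_labels_eq_card {m : ℕ} (y : Fin m → Fin 2) (σ : Equiv.Perm (Fin m)) (k : ℕ) :
    ∑ j : Fin m with j.val < k, (((y (σ j)).val : ℕ) : ℝ) =
      ((Finset.univ.filter fun j : Fin m => j.val < k ∧ y (σ j) = 1).card : ℝ) := by
  rw [← Finset.filter_filter, Finset.card_filter]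
  push_cast
  refine Finset.sum_congr rfl fun j _ => ?_
  generalize y (σ j) = b
  fin_cases b <;> simp

theorem knn_eq_one {m : ℕ} (p : Fin m → E) (y : Fin m → Fin 2) (x : E) (s : ℝ) (k : ℕ)
    (hk : 0 < k) (hN : (Finset.univ.filter fun i => ‖p i - x‖ < s).card ≤ k)
    (h : (k : ℝ) / 2 < ((Finset.univ.filter fun i => ‖p i - x‖ < s ∧ y i = 1).card : ℝ)) :
    knn p y k x = 1 := by
  unfold knn
  simp only [sum_labels_eq_card]
  have h1 := card_label_le p y x s k hN 1
  have hk' : (0 : ℝ) < k := by exact_mod_cast hk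
  rw [if_pos]
  rw [one_div_mul_eq_div, lt_div_iff₀ hk']
  have : ((Finset.univ.filter fun i => ‖p i - x‖ < s ∧ y i = 1).card : ℝ) ≤ _ :=
    Nat.cast_le.2 h1
  linarith

theorem knn_eq_zero {m : ℕ} (p : Fin m → E) (y : Fin m → Fin 2) (x : E) (s : ℝ) (k : ℕ)
    (hk : 0 < k) (hN : (Finset.univ.filter fun i => ‖p i - x‖ < s).card ≤ k)
    (h : (k : ℝ) / 2 < ((Finset.univ.filter fun i => ‖p i - x‖ < s ∧ y i = 0).card : ℝ)) :
    knn p y k x = 0 := by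
  unfold knn
  simp only [sum_labels_eq_card]
  have h1 := card_label_le p y x s k hN 0
  have hk' : (0 : ℝ) < k := by exact_mod_cast hk
  set σ := Tuple.sort fun i => ‖p i - x‖ with hσ
  -- The two labels share at most `k` places, so more than `k / 2` zeros leave fewer than `k / 2`
  -- ones.
  have h2 : (Finset.univ.filter fun j : Fin m => j.val < k ∧ y (σ j) = 0).card +
      (Finset.univ.filter fun j : Fin m => j.val < k ∧ y (σ j) = 1).card ≤ k := by
    rw [← Finset.card_union_of_disjoint]
    · calc _ ≤ (Finset.univ.filter fun j : Fin m => j.val < k).card := by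
            refine Finset.card_le_card fun j hj => ?_
            simp only [Finset.mem_union, Finset.mem_filter, Finset.mem_univ, true_and] at hj ⊢
            tauto
        _ ≤ (Finset.range k).card := by
            refine Finset.card_le_card_of_injOn Fin.val ?_ Fin.val_injective.injOn
            intro j hj
            simpa using hj
        _ = k := Finset.card_range k
    · refine Finset.disjoint_left.2 fun j hj hj' => ?_
      simp only [Finset.mem_filter, Finset.mem_univ, true_and] at hj hj'
      exact absurd (hj.2.symm.trans hj'.2) (by decide)
  rw [if_neg]
  rw [one_div_mul_eq_div, lt_div_iff₀ hk', not_lt]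
  have h3 : ((Finset.univ.filter fun i => ‖p i - x‖ < s ∧ y i = 0).card : ℝ) ≤ _ :=
    Nat.cast_le.2 h1
  have h4 : (((Finset.univ.filter fun j : Fin m => j.val < k ∧ y (σ j) = 0).card : ℕ) : ℝ) +
      ((Finset.univ.filter fun j : Fin m => j.val < k ∧ y (σ j) = 1).card : ℕ) ≤ k := by
    exact_mod_cast h2
  linarith

/-- The number of points of a sample in the ball of centre `x` and radius `s`. -/
def ballCount {n : ℕ} (x : E) (s : ℝ) (p : Fin n → E) : ℝ :=
  ∑ i, (Metric.ball x s).indicator 1 (p i)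

theorem indicator_ball_eq (x z : E) (s : ℝ) :
    (Metric.ball x s).indicator (1 : E → ℝ) z = if ‖z - x‖ < s then 1 else 0 := by
  by_cases h : ‖z - x‖ < s <;> simp [h, dist_eq_norm]

theorem card_ball_append {n : ℕ} (S : (Fin n → E) × (Fin n → E)) (x : E) (s : ℝ) :
    (((Finset.univ.filter fun i => ‖Fin.append S.1 S.2 i - x‖ < s).card : ℕ) : ℝ) =
      ballCount x s S.1 + ballCount x s S.2 := by
  rw [Finset.card_filter, Fin.sum_univ_add]
  simp [ballCount, indicator_ball_eq, -Finset.sum_boole,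
    -Fin.natAdd_eq_addNat]

theorem card_ball_append_one {n : ℕ} (S : (Fin n → E) × (Fin n → E)) (x : E) (s : ℝ) :
    (((Finset.univ.filter fun i => ‖Fin.append S.1 S.2 i - x‖ < s ∧
      Fin.append (fun _ : Fin n => (0 : Fin 2)) (fun _ : Fin n => 1) i = 1).card : ℕ) : ℝ) =
      ballCount x s S.2 := by
  rw [Finset.card_filter, Fin.sum_univ_add]
  simp [ballCount, indicator_ball_eq, -Finset.sum_boole,
    -Fin.natAdd_eq_addNat]

theorem card_ball_append_zero {n : ℕ} (S : (Fin n → E) × (Fin n → E)) (x : E) (s : ℝ) :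
    (((Finset.univ.filter fun i => ‖Fin.append S.1 S.2 i - x‖ < s ∧
      Fin.append (fun _ : Fin n => (0 : Fin 2)) (fun _ : Fin n => 1) i = 0).card : ℕ) : ℝ) =
      ballCount x s S.1 := by
  rw [Finset.card_filter, Fin.sum_univ_add]
  simp [ballCount, indicator_ball_eq, -Finset.sum_boole,
    -Fin.natAdd_eq_addNat]

theorem knnSDA_eq_one {n : ℕ} (S : (Fin n → E) × (Fin n → E)) (x : E) (s : ℝ) (k : ℕ)
    (hk : 0 < k) (hN : ballCount x s S.1 + ballCount x s S.2 ≤ k)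
    (h : (k : ℝ) / 2 < ballCount x s S.2) : knnSDA k S x = 1 := by
  refine knn_eq_one _ _ x s k hk ?_ ?_
  · rw [← card_ball_append] at hN
    exact_mod_cast hN
  · rwa [card_ball_append_one]

theorem knnSDA_eq_zero {n : ℕ} (S : (Fin n → E) × (Fin n → E)) (x : E) (s : ℝ) (k : ℕ)
    (hk : 0 < k) (hN : ballCount x s S.1 + ballCount x s S.2 ≤ k)
    (h : (k : ℝ) / 2 < ballCount x s S.1) : knnSDA k S x = 0 := by
  refine knn_eq_zero _ _ x s k hk ?_ ?_
  · rw [← card_ball_append] at hN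
    exact_mod_cast hN
  · rwa [card_ball_append_zero]

end Combinatorics

/-! ### Joint measurability of the rule in the samples and the query point. -/

section Measurability

variable {E : Type*} [NormedAddCommGroup E] [MeasurableSpace E] [BorelSpace E]
  [SecondCountableTopology E]

/-- The sorting permutation is characterised by finitely many comparisons of distances, together
with index order on ties. The rule depends on the points only through this permutation, which takes
finitely many values. -/
theorem measurableSet_sort_norm_eq {m : ℕ} (σ : Equiv.Perm (Fin m)) :
    MeasurableSet {q : (Fin m → E) × E | (Tuple.sort fun i => ‖q.1 i - q.2‖) = σ} := by
  have h : {q : (Fin m → E) × E | (Tuple.sort fun i => ‖q.1 i - q.2‖) = σ} =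
      {q | ∀ i j, i ≤ j → ‖q.1 (σ i) - q.2‖ ≤ ‖q.1 (σ j) - q.2‖} ∩
      {q | ∀ i j, i < j → ‖q.1 (σ i) - q.2‖ = ‖q.1 (σ j) - q.2‖ → σ i < σ j} := by
    ext q
    simp only [Set.mem_inter_iff, Set.mem_ofPred_eq]
    rw [eq_comm, Tuple.eq_sort_iff]
    rfl
  have hm : ∀ i, Measurable fun q : (Fin m → E) × E => ‖q.1 (σ i) - q.2‖ := fun i => by fun_prop
  rw [h]
  refine MeasurableSet.inter ?_ ?_
  · simp only [Set.ofPred_forall]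
    exact MeasurableSet.iInter fun i => MeasurableSet.iInter fun j => MeasurableSet.iInter fun _ =>
      measurableSet_le (hm i) (hm j)
  · simp only [Set.ofPred_forall]
    refine MeasurableSet.iInter fun i => MeasurableSet.iInter fun j => MeasurableSet.iInter fun _ =>
      ?_
    simp only [imp_iff_not_or, Set.ofPred_or]
    exact (measurableSet_eq_fun (hm i) (hm j)).compl.union (MeasurableSet.const _)

theorem measurableSet_knn_eq {m : ℕ} (y : Fin m → Fin 2) (k : ℕ) (b : Fin 2) :
    MeasurableSet {q : (Fin m → E) × E | knn q.1 y k q.2 = b} := by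
  let F : Equiv.Perm (Fin m) → Fin 2 := fun σ =>
    if 1 / 2 < (1 / (k : ℝ)) * ∑ j : Fin m with j.val < k, (((y (σ j)).val : ℕ) : ℝ) then 1 else 0
  have h : {q : (Fin m → E) × E | knn q.1 y k q.2 = b} =
      ⋃ σ ∈ {σ | F σ = b}, {q : (Fin m → E) × E | (Tuple.sort fun i => ‖q.1 i - q.2‖) = σ} := by
    ext q
    simp only [Set.mem_iUnion, Set.mem_ofPred_eq, exists_prop, exists_eq_right']
    rfl
  rw [h]
  exact MeasurableSet.biUnion (Set.to_countable _) fun σ _ => measurableSet_sort_norm_eq σ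

theorem measurableSet_knnSDA_eq {n : ℕ} (k : ℕ) (b : Fin 2) :
    MeasurableSet {q : ((Fin n → E) × (Fin n → E)) × E | knnSDA k q.1 q.2 = b} := by
  have h : Measurable fun q : ((Fin n → E) × (Fin n → E)) × E =>
      ((Fin.append q.1.1 q.1.2, q.2) : (Fin (n + n) → E) × E) := by
    refine Measurable.prodMk (measurable_pi_lambda _ fun i => ?_) measurable_snd
    refine Fin.addCases (fun j => ?_) (fun j => ?_) i
    · simp only [Fin.append_left]; fun_prop
    · simp only [Fin.append_right]; fun_prop
  exact h (measurableSet_knn_eq (Fin.append (fun _ : Fin n => 0) (fun _ : Fin n => 1)) k b)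

omit [SecondCountableTopology E] in
theorem measurable_ballCount {n : ℕ} (x : E) (s : ℝ) :
    Measurable fun p : Fin n → E => ballCount x s p :=
  Finset.measurable_sum _ fun i _ =>
    (measurable_one.indicator measurableSet_ball).comp (measurable_pi_apply i)

end Measurability

/-! ### Exponential bounds for ball counts and for the error at a point. -/

section Chernoff

theorem integral_exp_mul_indicator {E : Type*} [MeasurableSpace E] (P : Measure E)
    [IsProbabilityMeasure P] {A : Set E} (hA : MeasurableSet A) (t : ℝ) :
    ∫ z, Real.exp (t * A.indicator 1 z) ∂P = 1 + P.real A * (Real.exp t - 1) := by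
  have h : ∀ z, Real.exp (t * A.indicator 1 z) =
      1 + A.indicator (fun _ => Real.exp t - 1) z := by
    intro z
    by_cases hz : z ∈ A <;> simp [hz]
  simp_rw [h]
  rw [integral_add (integrable_const _) ((integrable_const _).indicator hA),
    integral_indicator_const _ hA]
  simp

variable {E : Type*} [NormedAddCommGroup E] [MeasurableSpace E] [BorelSpace E]

theorem integrable_exp_mul_ballCount (P : Measure E) [IsProbabilityMeasure P] (n : ℕ) (x : E)
    (s t : ℝ) :
    Integrable (fun p : Fin n → E => Real.exp (t * ballCount x s p))
      (Measure.pi fun _ : Fin n => P) := by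
  refine Integrable.of_bound (C := Real.exp (|t| * n))
    (((measurable_ballCount x s).const_mul t).exp.aestronglyMeasurable) (ae_of_all _ fun p => ?_)
  rw [Real.norm_eq_abs, Real.abs_exp, Real.exp_le_exp]
  have h0 : 0 ≤ ballCount x s p :=
    Finset.sum_nonneg fun i _ => Set.indicator_nonneg (fun _ _ => zero_le_one) _
  have h1 : ballCount x s p ≤ n := by
    calc ballCount x s p ≤ ∑ _i : Fin n, (1 : ℝ) :=
          Finset.sum_le_sum fun i _ => Set.indicator_le_self' (fun _ _ => zero_le_one) _
      _ = n := by simp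
  calc t * ballCount x s p ≤ |t| * ballCount x s p := by gcongr; exact le_abs_self t
    _ ≤ |t| * n := by gcongr

/-- By independence the integral is the `n`-th power of a Bernoulli moment generating function, and
`1 + v ≤ exp v` bounds each factor. -/
theorem integral_exp_mul_ballCount_le (P : Measure E) [IsProbabilityMeasure P] (n : ℕ) (x : E)
    (s t : ℝ) :
    ∫ p, Real.exp (t * ballCount x s p) ∂(Measure.pi fun _ : Fin n => P) ≤
      Real.exp (n * P.real (Metric.ball x s) * (Real.exp t - 1)) := by
  have h : ∀ p : Fin n → E, Real.exp (t * ballCount x s p) =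
      ∏ i, Real.exp (t * (Metric.ball x s).indicator 1 (p i)) := by
    intro p
    rw [← Real.exp_sum, ballCount, Finset.mul_sum]
  simp_rw [h]
  rw [integral_fintype_prod_eq_pow (fun z => Real.exp (t * (Metric.ball x s).indicator 1 z)),
    Fintype.card_fin, mul_assoc, Real.exp_nat_mul]
  refine pow_le_pow_left₀ (integral_nonneg fun _ => (Real.exp_pos _).le) ?_ n
  rw [integral_exp_mul_indicator P measurableSet_ball]
  linarith [Real.add_one_le_exp (P.real (Metric.ball x s) * (Real.exp t - 1))]

/-- A Chernoff bound for a linear combination of the numbers of points of two independent samples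
in a ball. -/
theorem measureReal_ballCount_ge_le (P Q : Measure E) [IsProbabilityMeasure P]
    [IsProbabilityMeasure Q] (n : ℕ) (x : E) (s t u a : ℝ) :
    ((Measure.pi fun _ : Fin n => P).prod (Measure.pi fun _ : Fin n => Q)).real
        {S | a ≤ t * ballCount x s S.1 + u * ballCount x s S.2} ≤
      Real.exp (n * P.real (Metric.ball x s) * (Real.exp t - 1) +
        n * Q.real (Metric.ball x s) * (Real.exp u - 1) - a) := by
  set PP := Measure.pi fun _ : Fin n => P
  set QQ := Measure.pi fun _ : Fin n => Q
  have hI := (integrable_exp_mul_ballCount P n x s t).mul_prod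
    (integrable_exp_mul_ballCount Q n x s u)
  have h := ProbabilityTheory.measure_ge_le_exp_mul_mgf (μ := PP.prod QQ)
    (X := fun S => t * ballCount x s S.1 + u * ballCount x s S.2) a zero_le_one
    (by simpa only [one_mul, Real.exp_add] using hI)
  refine h.trans ?_
  unfold ProbabilityTheory.mgf
  simp only [one_mul, Real.exp_add]
  rw [integral_prod_mul (fun p => Real.exp (t * ballCount x s p))
    (fun p => Real.exp (u * ballCount x s p)), sub_eq_neg_add, Real.exp_add, Real.exp_add,
    neg_one_mul]
  gcongr
  · exact integral_exp_mul_ballCount_le P n x s t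
  · exact integral_exp_mul_ballCount_le Q n x s u

theorem exp_sub_one_le {t : ℝ} (h0 : |t| ≤ 1) : Real.exp t - 1 ≤ t + t ^ 2 := by
  linarith [(abs_le.1 (Real.abs_exp_sub_one_sub_id_le h0)).2]

/-- Exponent for the event that the ball holds at least `k` points. The gap `k * D / 8` between `k`
and the mean, at tilt `D / 16`, gains `k * D ^ 2 / 128`; the quadratic term of the exponential costs
at most half of it. -/
theorem upper_tail_exponent_le {k D T : ℝ} (hk : 0 ≤ k) (hD : 0 ≤ D) (hD' : D ≤ 1 / 2)
    (hT : T = k * (1 - D / 8)) :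
    T * (Real.exp (D / 16) - 1) - D / 16 * k ≤ -(k * D ^ 2 / 256) := by
  have h1 : Real.exp (D / 16) - 1 ≤ D / 16 + (D / 16) ^ 2 :=
    exp_sub_one_le (by rw [abs_of_nonneg] <;> linarith)
  have hT0 : 0 ≤ T := hT ▸ mul_nonneg hk (by linarith)
  have h2 := mul_le_mul_of_nonneg_left h1 hT0
  have h3 : T * (D / 16 + (D / 16) ^ 2) - D / 16 * k =
      -(k * D ^ 2 / 256) - k * D ^ 3 / 2048 := by rw [hT]; ring
  have : 0 ≤ k * D ^ 3 := by positivity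
  linarith

/-- Exponent for the event that the Bayes label occurs at most `k / 2` times in the ball. Its mean
`m` is at least `k / 2 * (1 + D) * (1 - D / 8)`, hence at least `k / 2 * (1 + D / 2)`: the bias in
favour of the label outweighs the reduced mass of the ball. -/
theorem lower_tail_exponent_le {k D T m : ℝ} (hk : 0 ≤ k) (hD : 0 ≤ D) (hD' : D ≤ 1 / 2)
    (hT : T = k * (1 - D / 8)) (hm : (1 / 2 + D / 2) * T ≤ m) :
    m * (Real.exp (-(D / 16)) - 1) + D / 16 * (k / 2) ≤ -(k * D ^ 2 / 256) := by
  have h1 : Real.exp (-(D / 16)) - 1 ≤ -(D / 16) + (-(D / 16)) ^ 2 :=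
    exp_sub_one_le (by rw [abs_neg, abs_of_nonneg] <;> linarith)
  have hT0 : 0 ≤ T := hT ▸ mul_nonneg hk (by linarith)
  have hm0 : k / 2 * (1 + D / 2) ≤ m := by
    refine le_trans ?_ hm
    rw [hT]
    have : 0 ≤ k * D * (3 - D) := mul_nonneg (by positivity) (by linarith)
    nlinarith
  have hm00 : 0 ≤ m := le_trans (by positivity) hm0
  have h2 := mul_le_mul_of_nonneg_left h1 hm00
  have h3 : 0 ≤ D / 16 - (D / 16) ^ 2 := by nlinarith
  have h4 := mul_le_mul_of_nonneg_right hm0 h3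
  have h5 : k / 2 * (1 + D / 2) * (D / 16 - (D / 16) ^ 2) =
      D / 16 * (k / 2) + k * D ^ 2 / 256 + k * D ^ 2 * (10 - D) / 1024 := by ring
  have h6 : 0 ≤ k * D ^ 2 * (10 - D) := mul_nonneg (by positivity) (by linarith)
  nlinarith

/-- If the mass of the ball is slightly below `k / n` and its share of label `1` is at least
`1 / 2 + D / 2`, the rule outputs `1` at its centre with large probability. -/
theorem measureReal_knnSDA_ne_one_le (P Q : Measure E) [IsProbabilityMeasure P]
    [IsProbabilityMeasure Q] (n k : ℕ) (hk : 0 < k) (x : E) (s D : ℝ) (hD : 0 ≤ D)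
    (hD' : D ≤ 1 / 2)
    (hT : n * (P.real (Metric.ball x s) + Q.real (Metric.ball x s)) = k * (1 - D / 8))
    (hQ : (1 / 2 + D / 2) * (P.real (Metric.ball x s) + Q.real (Metric.ball x s)) ≤
      Q.real (Metric.ball x s)) :
    ((Measure.pi fun _ : Fin n => P).prod (Measure.pi fun _ : Fin n => Q)).real
        {S | knnSDA k S x ≠ 1} ≤ 2 * Real.exp (-(k * D ^ 2 / 256)) := by
  have hk0 : (0 : ℝ) ≤ k := k.cast_nonneg
  have h1 := measureReal_ballCount_ge_le P Q n x s (D / 16) (D / 16) (D / 16 * k)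
  -- Tilt `0` on the first sample: only the points of label `1` are counted here.
  have h2 := measureReal_ballCount_ge_le P Q n x s 0 (-(D / 16)) (-(D / 16 * (k / 2)))
  have e1 := upper_tail_exponent_le hk0 hD hD' hT
  have e2 := lower_tail_exponent_le (m := n * Q.real (Metric.ball x s)) hk0 hD hD' hT (by
    have := mul_le_mul_of_nonneg_left hQ (Nat.cast_nonneg n : (0 : ℝ) ≤ n)
    linarith)
  have hsub : {S : (Fin n → E) × (Fin n → E) | knnSDA k S x ≠ 1} ⊆
      {S | D / 16 * k ≤ D / 16 * ballCount x s S.1 + D / 16 * ballCount x s S.2} ∪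
      {S | -(D / 16 * (k / 2)) ≤ 0 * ballCount x s S.1 + -(D / 16) * ballCount x s S.2} := by
    intro S hS
    by_contra hcon
    simp only [Set.mem_union, Set.mem_ofPred_eq, not_or, not_le] at hcon hS
    have hc1 : D / 16 * (ballCount x s S.1 + ballCount x s S.2) < D / 16 * k := by linarith
    have hc2 : D / 16 * (k / 2) < D / 16 * ballCount x s S.2 := by linarith
    exact hS (knnSDA_eq_one S x s k hk (lt_of_mul_lt_mul_left hc1 (by positivity)).le
      (lt_of_mul_lt_mul_left hc2 (by positivity)))
  refine (measureReal_mono hsub).trans ((measureReal_union_le _ _).trans ?_)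
  have h1' := h1.trans (Real.exp_le_exp.2 (show _ ≤ -(k * D ^ 2 / 256) by linarith))
  have h2' := h2.trans (Real.exp_le_exp.2 (show _ ≤ -(k * D ^ 2 / 256) by
    rw [Real.exp_zero]; linarith))
  linarith

/-- The same argument with the two samples exchanged. -/
theorem measureReal_knnSDA_ne_zero_le (P Q : Measure E) [IsProbabilityMeasure P]
    [IsProbabilityMeasure Q] (n k : ℕ) (hk : 0 < k) (x : E) (s D : ℝ) (hD : 0 ≤ D)
    (hD' : D ≤ 1 / 2)
    (hT : n * (P.real (Metric.ball x s) + Q.real (Metric.ball x s)) = k * (1 - D / 8))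
    (hP : (1 / 2 + D / 2) * (P.real (Metric.ball x s) + Q.real (Metric.ball x s)) ≤
      P.real (Metric.ball x s)) :
    ((Measure.pi fun _ : Fin n => P).prod (Measure.pi fun _ : Fin n => Q)).real
        {S | knnSDA k S x ≠ 0} ≤ 2 * Real.exp (-(k * D ^ 2 / 256)) := by
  have hk0 : (0 : ℝ) ≤ k := k.cast_nonneg
  have h1 := measureReal_ballCount_ge_le P Q n x s (D / 16) (D / 16) (D / 16 * k)
  have h2 := measureReal_ballCount_ge_le P Q n x s (-(D / 16)) 0 (-(D / 16 * (k / 2)))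
  have e1 := upper_tail_exponent_le hk0 hD hD' hT
  have e2 := lower_tail_exponent_le (m := n * P.real (Metric.ball x s)) hk0 hD hD' hT (by
    have := mul_le_mul_of_nonneg_left hP (Nat.cast_nonneg n : (0 : ℝ) ≤ n)
    linarith)
  have hsub : {S : (Fin n → E) × (Fin n → E) | knnSDA k S x ≠ 0} ⊆
      {S | D / 16 * k ≤ D / 16 * ballCount x s S.1 + D / 16 * ballCount x s S.2} ∪
      {S | -(D / 16 * (k / 2)) ≤ -(D / 16) * ballCount x s S.1 + 0 * ballCount x s S.2} := by
    intro S hS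
    by_contra hcon
    simp only [Set.mem_union, Set.mem_ofPred_eq, not_or, not_le] at hcon hS
    have hc1 : D / 16 * (ballCount x s S.1 + ballCount x s S.2) < D / 16 * k := by linarith
    have hc2 : D / 16 * (k / 2) < D / 16 * ballCount x s S.1 := by linarith
    exact hS (knnSDA_eq_zero S x s k hk (lt_of_mul_lt_mul_left hc1 (by positivity)).le
      (lt_of_mul_lt_mul_left hc2 (by positivity)))
  refine (measureReal_mono hsub).trans ((measureReal_union_le _ _).trans ?_)
  have h1' := h1.trans (Real.exp_le_exp.2 (show _ ≤ -(k * D ^ 2 / 256) by linarith))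
  have h2' := h2.trans (Real.exp_le_exp.2 (show _ ≤ -(k * D ^ 2 / 256) by
    rw [Real.exp_zero]; linarith))
  linarith

end Chernoff

/-! ### Elementary properties of the regression function. -/

section Regression

variable {E : Type*} {f g : E → ℝ}

/-- The density of the excess of the risk of a wrong decision. -/
def excess (f g : E → ℝ) (x : E) : ℝ := |regression f g x - 1 / 2| * (f x + g x)

/-- Where `f + g` vanishes so does `g`, so the default value of the division does no harm. -/
theorem regression_mul_add (hf : ∀ x, 0 ≤ f x) (hg : ∀ x, 0 ≤ g x) (x : E) :
    regression f g x * (f x + g x) = g x := by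
  by_cases h : f x + g x = 0
  · rw [h, mul_zero]; linarith [hf x, hg x]
  · exact div_mul_cancel₀ _ h

theorem regression_nonneg (hf : ∀ x, 0 ≤ f x) (hg : ∀ x, 0 ≤ g x) (x : E) :
    0 ≤ regression f g x := div_nonneg (hg x) (add_nonneg (hf x) (hg x))

theorem regression_le_one (hf : ∀ x, 0 ≤ f x) (hg : ∀ x, 0 ≤ g x) (x : E) :
    regression f g x ≤ 1 :=
  div_le_one_of_le₀ (by linarith [hf x]) (add_nonneg (hf x) (hg x))

theorem abs_regression_sub_le (hf : ∀ x, 0 ≤ f x) (hg : ∀ x, 0 ≤ g x) (x : E) :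
    |regression f g x - 1 / 2| ≤ 1 / 2 := by
  rw [abs_le]
  constructor <;> linarith [regression_nonneg hf hg x, regression_le_one hf hg x]

end Regression

/-! ### Densities and the excess risk of a fixed rule. -/

section Density

variable {E : Type*} [MeasurableSpace E] {lam : Measure E} {f g : E → ℝ}

theorem IsDensity.integrable (hf : IsDensity lam f) : Integrable f lam := by
  refine ⟨hf.measurable.aestronglyMeasurable, ?_⟩
  rw [hasFiniteIntegral_iff_ofReal (ae_of_all _ hf.nonneg), hf.lintegral_eq_one]
  exact ENNReal.one_lt_top

theorem IsDensity.integral_eq_one (hf : IsDensity lam f) : ∫ x, f x ∂lam = 1 := by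
  rw [integral_eq_lintegral_of_nonneg_ae (ae_of_all _ hf.nonneg)
    hf.measurable.aestronglyMeasurable, hf.lintegral_eq_one, ENNReal.toReal_one]

theorem IsDensity.isProbabilityMeasure_law (hf : IsDensity lam f) :
    IsProbabilityMeasure (law lam f) :=
  ⟨by rw [law, withDensity_apply _ MeasurableSet.univ, Measure.restrict_univ, hf.lintegral_eq_one]⟩

theorem IsDensity.law_real (hf : IsDensity lam f) {A : Set E} (hA : MeasurableSet A) :
    (law lam f).real A = ∫ x in A, f x ∂lam := by
  rw [measureReal_def, law, withDensity_apply _ hA,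
    integral_eq_lintegral_of_nonneg_ae (ae_of_all _ hf.nonneg)
      hf.measurable.aestronglyMeasurable]

theorem isProbabilityMeasure_sampleLaw (hf : IsDensity lam f) (hg : IsDensity lam g) (n : ℕ) :
    IsProbabilityMeasure (sampleLaw lam f g n) := by
  have := hf.isProbabilityMeasure_law
  have := hg.isProbabilityMeasure_law
  unfold sampleLaw
  infer_instance

theorem measurable_regression (hf : Measurable f) (hg : Measurable g) :
    Measurable (regression f g) := hg.div (hf.add hg)

theorem measurableSet_bayes_eq (hf : Measurable f) (hg : Measurable g) (b : Fin 2) :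
    MeasurableSet {x | bayes f g x = b} := by
  have h : Measurable (bayes f g) :=
    Measurable.ite (measurableSet_le measurable_const (measurable_regression hf hg))
      measurable_const measurable_const
  exact h (measurableSet_singleton b)

theorem integrable_excess (hf : IsDensity lam f) (hg : IsDensity lam g) :
    Integrable (excess f g) lam := by
  refine (hf.integrable.add hg.integrable).mono'
    (((measurable_regression hf.measurable hg.measurable).sub_const _).abs.mul
      (hf.measurable.add hg.measurable)).aestronglyMeasurable (ae_of_all _ fun x => ?_)
  have h0 := add_nonneg (hf.nonneg x) (hg.nonneg x)
  rw [excess, Real.norm_of_nonneg (mul_nonneg (abs_nonneg _) h0)]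
  exact mul_le_of_le_one_left h0
    ((abs_regression_sub_le hf.nonneg hg.nonneg x).trans (by norm_num))

theorem risk_eq_integral (hf : IsDensity lam f) (hg : IsDensity lam g) (φ : E → Fin 2)
    (hφ : ∀ b, MeasurableSet {x | φ x = b}) :
    risk lam f g φ = ∫ x, 1 / 2 *
      ({x | φ x = 1}.indicator f x + {x | φ x = 0}.indicator g x) ∂lam := by
  rw [integral_const_mul, integral_add (hf.integrable.indicator (hφ 1))
    (hg.integrable.indicator (hφ 0)), integral_indicator (hφ 1), integral_indicator (hφ 0), risk]

/-- A wrong decision at `x` exchanges the costs `f x / 2` and `g x / 2`, whose difference is `(η -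
1/2) * (f + g)` up to sign. Bayes pays the smaller one. -/
theorem risk_sub_risk_bayes (hf : IsDensity lam f) (hg : IsDensity lam g) (φ : E → Fin 2)
    (hφ : ∀ b, MeasurableSet {x | φ x = b}) :
    risk lam f g φ - risk lam f g (bayes f g) =
      ∫ x, {x | φ x ≠ bayes f g x}.indicator (excess f g) x ∂lam := by
  have hb := measurableSet_bayes_eq hf.measurable hg.measurable
  rw [risk_eq_integral hf hg φ hφ, risk_eq_integral hf hg _ hb, ← integral_sub]
  · refine integral_congr_ae (ae_of_all _ fun x => ?_)
    have hx := regression_mul_add hf.nonneg hg.nonneg x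
    have hab : ∀ b : Fin 2, b = 0 ∨ b = 1 := by decide
    have h0 := add_nonneg (hf.nonneg x) (hg.nonneg x)
    by_cases hη : 1 / 2 ≤ regression f g x
    · have hbx : bayes f g x = 1 := if_pos hη
      rcases hab (φ x) with h | h
      · simp only [Set.indicator_apply, Set.mem_ofPred_eq, h, hbx, excess]
        rw [abs_of_nonneg (by linarith)]
        simp
        linarith
      · simp [h, hbx]
    · have hbx : bayes f g x = 0 := if_neg hη
      rcases hab (φ x) with h | h
      · simp [h, hbx]
      · simp only [Set.indicator_apply, Set.mem_ofPred_eq, h, hbx, excess]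
        rw [abs_of_neg (by linarith)]
        simp
        linarith
  · exact ((hf.integrable.indicator (hφ 1)).add (hg.integrable.indicator (hφ 0))).const_mul _
  · exact ((hf.integrable.indicator (hb 1)).add (hg.integrable.indicator (hb 0))).const_mul _

end Density

/-! ### Expected excess risk over the samples, by Fubini. -/

section Model

variable {E : Type*} [NormedAddCommGroup E] [MeasurableSpace E] [BorelSpace E]
  [SecondCountableTopology E] {lam : Measure E} {f g : E → ℝ}

theorem measurableSet_knnSDA_ne_bayes (hf : IsDensity lam f) (hg : IsDensity lam g) (n k : ℕ) :
    MeasurableSet {q : ((Fin n → E) × (Fin n → E)) × E | knnSDA k q.1 q.2 ≠ bayes f g q.2} := by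
  have h : {q : ((Fin n → E) × (Fin n → E)) × E | knnSDA k q.1 q.2 ≠ bayes f g q.2} =
      ⋃ b : Fin 2, {q | knnSDA k q.1 q.2 = b} ∩ (Prod.snd ⁻¹' {x | bayes f g x = b})ᶜ := by
    ext q
    simp [eq_comm]
  rw [h]
  exact MeasurableSet.iUnion fun b => (measurableSet_knnSDA_eq k b).inter
    (measurable_snd (measurableSet_bayes_eq hf.measurable hg.measurable b)).compl

theorem measurableSet_knnSDA_section {n : ℕ} (k : ℕ) (S : (Fin n → E) × (Fin n → E)) (b : Fin 2) :
    MeasurableSet {x | knnSDA k S x = b} :=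
  (measurable_prodMk_left : Measurable (Prod.mk S)) (measurableSet_knnSDA_eq k b)

theorem integrable_excess_mul (hf : IsDensity lam f) (hg : IsDensity lam g) (n k : ℕ) :
    Integrable (fun x => excess f g x *
      (sampleLaw lam f g n).real {S | knnSDA k S x ≠ bayes f g x}) lam := by
  have := isProbabilityMeasure_sampleLaw hf hg n
  refine (integrable_excess hf hg).mul_bdd (c := 1) ?_ ?_
  · exact (measurable_measure_prodMk_right (μ := sampleLaw lam f g n)
      (measurableSet_knnSDA_ne_bayes hf hg n k)).ennreal_toReal.aestronglyMeasurable
  · exact ae_of_all _ fun x => by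
      rw [Real.norm_of_nonneg measureReal_nonneg]; exact measureReal_le_one

variable [SFinite lam]

theorem integrable_indicator_excess (hf : IsDensity lam f) (hg : IsDensity lam g) (n k : ℕ) :
    Integrable (fun q : ((Fin n → E) × (Fin n → E)) × E =>
      {x | knnSDA k q.1 x ≠ bayes f g x}.indicator (excess f g) q.2)
      ((sampleLaw lam f g n).prod lam) := by
  have := isProbabilityMeasure_sampleLaw hf hg n
  exact ((integrable_excess hf hg).comp_snd (sampleLaw lam f g n)).indicator
    (measurableSet_knnSDA_ne_bayes hf hg n k)

theorem integrable_risk_knnSDA (hf : IsDensity lam f) (hg : IsDensity lam g) (n k : ℕ) :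
    Integrable (fun S => risk lam f g (knnSDA k S)) (sampleLaw lam f g n) := by
  have := isProbabilityMeasure_sampleLaw hf hg n
  have h := (integrable_indicator_excess hf hg n k).integral_prod_left.add
    (integrable_const (risk lam f g (bayes f g)))
  refine h.congr (ae_of_all _ fun S => ?_)
  simp only [Pi.add_apply]
  rw [← risk_sub_risk_bayes hf hg _ (measurableSet_knnSDA_section k S), sub_add_cancel]

/-- The excess risk of the nearest neighbour rule, as an integral of pointwise probabilities of
disagreement with the Bayes classifier. -/
theorem knnRisk_sub_risk_bayes (hf : IsDensity lam f) (hg : IsDensity lam g) (n k : ℕ) :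
    knnRisk lam f g n k - risk lam f g (bayes f g) =
      ∫ x, excess f g x * (sampleLaw lam f g n).real {S | knnSDA k S x ≠ bayes f g x} ∂lam := by
  have := isProbabilityMeasure_sampleLaw hf hg n
  have h1 : knnRisk lam f g n k - risk lam f g (bayes f g) =
      ∫ S, ∫ x, {x | knnSDA k S x ≠ bayes f g x}.indicator (excess f g) x ∂lam
        ∂(sampleLaw lam f g n) := by
    have h2 : risk lam f g (bayes f g) =
        ∫ _S, risk lam f g (bayes f g) ∂(sampleLaw lam f g n) := by simp
    rw [h2, knnRisk, ← integral_sub (integrable_risk_knnSDA hf hg n k) (integrable_const _)]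
    exact integral_congr_ae (ae_of_all _ fun S =>
      risk_sub_risk_bayes hf hg _ (measurableSet_knnSDA_section k S))
  rw [h1, integral_integral_swap (integrable_indicator_excess hf hg n k)]
  refine integral_congr_ae (ae_of_all _ fun x => ?_)
  have h3 : ∀ S : (Fin n → E) × (Fin n → E),
      {x | knnSDA k S x ≠ bayes f g x}.indicator (excess f g) x =
      {S | knnSDA k S x ≠ bayes f g x}.indicator (fun _ => excess f g x) S := fun S => rfl
  simp only [h3]
  have h4 : MeasurableSet {S : (Fin n → E) × (Fin n → E) | knnSDA k S x ≠ bayes f g x} :=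
    (measurable_prodMk_right : Measurable fun S : (Fin n → E) × (Fin n → E) => (S, x))
      (measurableSet_knnSDA_ne_bayes hf hg n k)
  rw [integral_indicator_const _ h4, smul_eq_mul, mul_comm]

end Model

/-! ### Probability of disagreement with Bayes at a point. -/

section Pointwise

variable {E : Type*} [NormedAddCommGroup E] [NormedSpace ℝ E] [FiniteDimensional ℝ E]
  [MeasurableSpace E] [BorelSpace E] {lam : Measure E} [lam.IsAddHaarMeasure] {f g : E → ℝ}

/-- Spheres are Haar-null in a nontrivial space, including the sphere of radius `0`, so dominated
convergence applies. Continuity allows a ball of prescribed mass to be chosen. -/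
theorem continuous_setIntegral_ball [Nontrivial E] {h : E → ℝ} (hh : Integrable h lam) (x : E) :
    Continuous fun s => ∫ z in Metric.ball x s, h z ∂lam := by
  simp_rw [← integral_indicator (μ := lam) (f := h) measurableSet_ball]
  rw [continuous_iff_continuousAt]
  intro s
  refine continuousAt_of_dominated (bound := fun z => ‖h z‖)
    (Filter.Eventually.of_forall fun t =>
      (hh.indicator measurableSet_ball).aestronglyMeasurable)
    (Filter.Eventually.of_forall fun t => ae_of_all _ fun z => norm_indicator_le_norm_self _ _)
    hh.norm ?_
  have hs : ∀ᵐ z ∂lam, z ∉ Metric.sphere x s :=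
    measure_eq_zero_iff_ae_notMem.1 (Measure.addHaar_sphere lam x s)
  filter_upwards [hs] with z hz
  rcases lt_or_gt_of_ne (show dist z x ≠ s from hz) with hlt | hlt
  · refine ContinuousAt.congr (continuousAt_const (y := h z)) ?_
    filter_upwards [lt_mem_nhds hlt] with t ht
    rw [Set.indicator_of_mem (Metric.mem_ball.2 ht)]
  · refine ContinuousAt.congr (continuousAt_const (y := 0)) ?_
    filter_upwards [gt_mem_nhds hlt] with t ht
    rw [Set.indicator_of_notMem (fun hz' => (Metric.mem_ball.1 hz').not_gt ht)]

/-- If the regression function varies little on a ball that carries mass at least `k / n`, the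
nearest neighbour rule agrees with the Bayes classifier at its centre with large probability. -/
theorem measureReal_knnSDA_ne_bayes_le [Nontrivial E] (hf : IsDensity lam f)
    (hg : IsDensity lam g) {x : E} {r D : ℝ} {n k : ℕ} (hn : 0 < n) (hk : 0 < k) (hr : 0 ≤ r)
    (hD : D = |regression f g x - 1 / 2|)
    (hη : ∀ z ∈ Metric.ball x r, 0 < f z + g z →
      |regression f g x - regression f g z| ≤ D / 2)
    (hm : (k : ℝ) / n ≤ ∫ z in Metric.ball x r, (f z + g z) ∂lam) :
    (sampleLaw lam f g n).real {S | knnSDA k S x ≠ bayes f g x} ≤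
      2 * Real.exp (-(k * D ^ 2 / 256)) := by
  have := hf.isProbabilityMeasure_law
  have := hg.isProbabilityMeasure_law
  have hD0 : 0 ≤ D := hD ▸ abs_nonneg _
  have hD1 : D ≤ 1 / 2 := hD ▸ abs_regression_sub_le hf.nonneg hg.nonneg x
  have hn' : (0 : ℝ) < n := Nat.cast_pos.2 hn
  have hk' : (0 : ℝ) < k := Nat.cast_pos.2 hk
  have hI := hf.integrable.add hg.integrable
  -- Each sample has `n` points, so a ball of `(f + g)`-mass `k * (1 - D / 8) / n` has expected
  -- count `k * (1 - D / 8)`. The intermediate value theorem finds its radius in `[0, r]`.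
  have hmem : (k * (1 - D / 8) / n : ℝ) ∈ Set.Icc (∫ z in Metric.ball x 0, (f z + g z) ∂lam)
      (∫ z in Metric.ball x r, (f z + g z) ∂lam) := by
    constructor
    · simp only [Metric.ball_zero, Measure.restrict_empty, integral_zero_measure]
      have : 0 ≤ 1 - D / 8 := by linarith
      positivity
    · refine le_trans ?_ hm
      gcongr
      exact mul_le_of_le_one_right hk'.le (by linarith)
  obtain ⟨s, ⟨hs0, hsr⟩, hs⟩ := intermediate_value_Icc hr
    (continuous_setIntegral_ball hI x).continuousOn hmem
  simp only [Pi.add_apply] at hs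
  have hsum : (law lam f).real (Metric.ball x s) + (law lam g).real (Metric.ball x s) =
      ∫ z in Metric.ball x s, (f z + g z) ∂lam := by
    rw [hf.law_real measurableSet_ball, hg.law_real measurableSet_ball,
      integral_add hf.integrable.integrableOn hg.integrable.integrableOn]
  have hT : n * ((law lam f).real (Metric.ball x s) + (law lam g).real (Metric.ball x s)) =
      k * (1 - D / 8) := by
    rw [hsum, hs]; field_simp
  have hzero : ∀ z, ¬ 0 < f z + g z → f z = 0 ∧ g z = 0 := fun z hz => by
    constructor <;> linarith [hf.nonneg z, hg.nonneg z]
  by_cases hx : 1 / 2 ≤ regression f g x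
  · have hbx : bayes f g x = 1 := if_pos hx
    rw [hbx]
    refine measureReal_knnSDA_ne_one_le _ _ n k hk x s D hD0 hD1 hT ?_
    rw [hsum, hg.law_real measurableSet_ball, ← integral_const_mul]
    refine setIntegral_mono_on (hI.const_mul _).integrableOn hg.integrable.integrableOn
      measurableSet_ball fun z hz => ?_
    by_cases h0 : 0 < f z + g z
    · have h1 := abs_le.1 (hη z (Metric.ball_subset_ball hsr hz) h0)
      rw [abs_of_nonneg (by linarith)] at hD
      calc (1 / 2 + D / 2) * (f z + g z) ≤ regression f g z * (f z + g z) := by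
            gcongr; linarith
        _ = g z := regression_mul_add hf.nonneg hg.nonneg z
    · simp [hzero z h0]
  · have hbx : bayes f g x = 0 := if_neg hx
    rw [hbx]
    refine measureReal_knnSDA_ne_zero_le _ _ n k hk x s D hD0 hD1 hT ?_
    rw [hsum, hf.law_real measurableSet_ball, ← integral_const_mul]
    refine setIntegral_mono_on (hI.const_mul _).integrableOn hf.integrable.integrableOn
      measurableSet_ball fun z hz => ?_
    by_cases h0 : 0 < f z + g z
    · have h1 := abs_le.1 (hη z (Metric.ball_subset_ball hsr hz) h0)
      rw [abs_of_neg (by linarith)] at hD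
      calc (1 / 2 + D / 2) * (f z + g z) ≤ (1 - regression f g z) * (f z + g z) := by
            gcongr; linarith
        _ = f z := by linarith [regression_mul_add hf.nonneg hg.nonneg z]
    · simp [hzero z h0]

end Pointwise

/-! ### Polynomial decay from the exponential bound, and summation over levels of `D`. -/

section Peeling

/-- A single term of the exponential series already dominates the power. Polynomial decay is enough
for peeling. -/
theorem exists_exp_neg_sq_le_rpow {c a : ℝ} (hc : 0 < c) :
    ∃ B : ℝ, 1 ≤ B ∧ ∀ u : ℝ, 1 ≤ u → 2 * Real.exp (-(c * u ^ 2)) ≤ B * u ^ (-a) := by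
  set m := ⌈a / 2⌉₊ with hm
  refine ⟨max 1 (2 * (m.factorial / c ^ m)), le_max_left _ _, fun u hu => ?_⟩
  have hu0 : 0 < u := by linarith
  have h1 : (c * u ^ 2) ^ m / m.factorial ≤ Real.exp (c * u ^ 2) :=
    Real.pow_div_factorial_le_exp _ (by positivity) m
  have h2 : u ^ a ≤ u ^ (2 * m) := by
    rw [← Real.rpow_natCast]
    refine Real.rpow_le_rpow_of_exponent_le hu ?_
    push_cast
    linarith [Nat.le_ceil (a / 2)]
  have hfac : (0 : ℝ) < m.factorial := by exact_mod_cast m.factorial_pos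
  have h3 : c ^ m / m.factorial * u ^ a ≤ Real.exp (c * u ^ 2) := by
    refine le_trans ?_ h1
    rw [mul_pow, ← pow_mul, mul_div_right_comm]
    gcongr
  have h4 : Real.exp (-(c * u ^ 2)) ≤ m.factorial / c ^ m * u ^ (-a) := by
    rw [Real.exp_neg, Real.rpow_neg hu0.le, ← inv_div, ← mul_inv]
    exact inv_anti₀ (by positivity) h3
  calc 2 * Real.exp (-(c * u ^ 2)) ≤ 2 * (m.factorial / c ^ m * u ^ (-a)) := by gcongr
    _ = 2 * (m.factorial / c ^ m) * u ^ (-a) := by ring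
    _ ≤ _ := by gcongr; exact le_max_right _ _

/-- Peeling: the integral of a function of order `D` that decays beyond `D = ε`, against a measure
under which small values of `D` are rare. -/
theorem integral_peeling_le {E : Type*} [MeasurableSpace E] {lam : Measure E} {m D q : E → ℝ}
    {α C B ε : ℝ} (hα : 0 < α) (hB : 1 ≤ B) (hε : 0 < ε)
    (hm : Integrable m lam) (hm0 : ∀ x, 0 ≤ m x) (hD : Measurable D) (hD0 : ∀ x, 0 ≤ D x)
    (hD1 : ∀ x, D x ≤ 1)
    (hmargin : ∀ t : ℝ, 0 < t → ∫ x in {x | 0 < D x ∧ D x < t}, m x ∂lam ≤ C * t ^ α)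
    (hq1 : ∀ x, q x ≤ 1)
    (hq : ∀ x, 0 < m x → ε ≤ D x → q x ≤ B * (D x / ε) ^ (-(α + 2)))
    (hint : Integrable (fun x => D x * m x * q x) lam) :
    ∫ x, D x * m x * q x ∂lam ≤ 2 * (C * B * 2 ^ (α + 2)) * ε ^ (1 + α) := by
  obtain ⟨J, hJ⟩ : ∃ J : ℕ, 1 / ε < 2 ^ J := pow_unbounded_of_one_lt _ (by norm_num)
  have hJ' : 1 < 2 ^ J * ε := by rwa [div_lt_iff₀ hε] at hJ
  -- The sets are nested, not annuli, so that the margin condition bounds each one directly. Points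
  -- with `D x = 0` lie in none, and there the integrand vanishes.
  set A : ℕ → Set E := fun j => {x | 0 < D x ∧ D x < 2 ^ j * ε} with hA
  have hAm : ∀ j, MeasurableSet (A j) := fun j =>
    (measurableSet_lt measurable_const hD).inter (measurableSet_lt hD measurable_const)
  -- Bound for `D * q` when `2 ^ (j - 1) * ε ≤ D < 2 ^ j * ε`, or `D < ε` if `j = 0`. The decay
  -- exponent `α + 2` leaves `2 ^ (-j * (α + 1))`; against the margin factor `2 ^ (j * α)` the sum
  -- is geometric of ratio `1 / 2`.
  set a : ℕ → ℝ := fun j => ε * B * 2 ^ (α + 2) * ((2 : ℝ) ^ j) ^ (-(α + 1)) with ha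
  have ha0 : ∀ j, 0 ≤ a j := fun j => by positivity
  have hB0 : 0 < B := by linarith
  have hC : 0 ≤ C := by
    have h1 := hmargin 1 one_pos
    rw [Real.one_rpow, mul_one] at h1
    exact (integral_nonneg hm0).trans h1
  have hstep : ∀ x, 0 < m x → 0 < D x → ∃ j ∈ Finset.range (J + 1), x ∈ A j ∧ D x * q x ≤ a j := by
    intro x hmx hx
    have hex : ∃ j : ℕ, D x < 2 ^ j * ε := ⟨J, (hD1 x).trans_lt hJ'⟩
    classical
    refine ⟨Nat.find hex, Finset.mem_range.2 (Nat.lt_succ_of_le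
      (Nat.find_min' hex ((hD1 x).trans_lt hJ'))), ⟨hx, Nat.find_spec hex⟩, ?_⟩
    have hspec := Nat.find_spec hex
    rcases hj : Nat.find hex with _ | i
    · rw [hj, pow_zero, one_mul] at hspec
      calc D x * q x ≤ D x * 1 := by gcongr; exact hq1 x
        _ ≤ ε * 1 * 1 := by linarith
        _ ≤ ε * B * 2 ^ (α + 2) := by
            gcongr
            exact Real.one_le_rpow (by norm_num) (by linarith)
        _ = a 0 := by simp [ha]
    · have hmin := Nat.find_min hex (m := i) (by omega)
      rw [hj] at hspec
      rw [not_lt] at hmin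
      have h2i : (1 : ℝ) ≤ 2 ^ i := one_le_pow₀ (by norm_num)
      have hεD : ε ≤ D x := le_trans (le_mul_of_one_le_left hε.le h2i) hmin
      have h2 : (D x / ε) ^ (-(α + 2)) ≤ ((2 : ℝ) ^ i) ^ (-(α + 2)) :=
        Real.rpow_le_rpow_of_nonpos (by positivity) ((le_div_iff₀ hε).2 hmin) (by linarith)
      calc D x * q x ≤ D x * (B * (D x / ε) ^ (-(α + 2))) := by gcongr; exact hq x hmx hεD
        _ ≤ (2 ^ (i + 1) * ε) * (B * ((2 : ℝ) ^ i) ^ (-(α + 2))) := by gcongr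
        _ = a (i + 1) := by
            simp only [ha]
            have e1 : ((2 : ℝ) ^ i) ^ (-(α + 2)) = ((2 : ℝ) ^ i) ^ (-(α + 1)) * (2 ^ i)⁻¹ := by
              rw [show -(α + 2) = -(α + 1) + -1 by ring, Real.rpow_add (by positivity),
                Real.rpow_neg_one]
            have e2 : ((2 : ℝ) ^ (i + 1)) ^ (-(α + 1)) =
                ((2 : ℝ) ^ i) ^ (-(α + 1)) * 2 ^ (-(α + 1)) := by
              rw [pow_succ, Real.mul_rpow (by positivity) (by positivity)]
            have e3 : (2 : ℝ) ^ (α + 2) * 2 ^ (-(α + 1)) = 2 := by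
              rw [← Real.rpow_add (by norm_num), show α + 2 + -(α + 1) = 1 by ring, Real.rpow_one]
            rw [e1, e2, pow_succ]
            have e4 : ε * B * 2 ^ (α + 2) * (((2 : ℝ) ^ i) ^ (-(α + 1)) * 2 ^ (-(α + 1))) =
                ε * B * (((2 : ℝ) ^ i) ^ (-(α + 1))) * (2 ^ (α + 2) * 2 ^ (-(α + 1))) := by ring
            rw [e4, e3]
            field_simp
  have hpt : ∀ x, D x * m x * q x ≤ ∑ j ∈ Finset.range (J + 1), a j * (A j).indicator m x := by
    intro x
    have hnn : ∀ j ∈ Finset.range (J + 1), 0 ≤ a j * (A j).indicator m x := fun j _ =>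
      mul_nonneg (ha0 j) (Set.indicator_nonneg (fun y _ => hm0 y) x)
    rcases (hm0 x).eq_or_lt with h0 | h0
    · rw [← h0]; simpa using Finset.sum_nonneg hnn
    rcases (hD0 x).eq_or_lt with h1 | h1
    · rw [← h1]; simpa using Finset.sum_nonneg hnn
    obtain ⟨j, hj, hxj, hle⟩ := hstep x h0 h1
    refine le_trans ?_ (Finset.single_le_sum hnn hj)
    rw [Set.indicator_of_mem hxj]
    nlinarith
  have hterm : ∀ j, a j * ∫ x in A j, m x ∂lam ≤
      C * B * 2 ^ (α + 2) * ε ^ (1 + α) * (1 / 2) ^ j := by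
    intro j
    calc a j * ∫ x in A j, m x ∂lam ≤ a j * (C * (2 ^ j * ε) ^ α) := by
          gcongr
          exact hmargin _ (by positivity)
      _ = C * B * 2 ^ (α + 2) * ε ^ (1 + α) * (1 / 2) ^ j := by
          simp only [ha]
          rw [Real.mul_rpow (by positivity) hε.le, Real.rpow_add hε, Real.rpow_one]
          have e1 : ((2 : ℝ) ^ j) ^ (-(α + 1)) * ((2 : ℝ) ^ j) ^ α = (1 / 2) ^ j := by
            rw [← Real.rpow_add (by positivity), show -(α + 1) + α = -1 by ring,
              Real.rpow_neg_one, one_div, inv_pow]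
          rw [← e1]
          ring
  calc ∫ x, D x * m x * q x ∂lam
      ≤ ∫ x, ∑ j ∈ Finset.range (J + 1), a j * (A j).indicator m x ∂lam :=
        integral_mono hint
          (integrable_finsetSum _ fun j _ => (hm.indicator (hAm j)).const_mul _) hpt
    _ = ∑ j ∈ Finset.range (J + 1), a j * ∫ x in A j, m x ∂lam := by
        rw [integral_finsetSum _ fun j _ => (hm.indicator (hAm j)).const_mul _]
        refine Finset.sum_congr rfl fun j _ => ?_
        rw [integral_const_mul, integral_indicator (hAm j)]
    _ ≤ ∑ j ∈ Finset.range (J + 1), C * B * 2 ^ (α + 2) * ε ^ (1 + α) * (1 / 2) ^ j :=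
        Finset.sum_le_sum fun j _ => hterm j
    _ ≤ C * B * 2 ^ (α + 2) * ε ^ (1 + α) * 2 := by
        rw [← Finset.mul_sum]
        gcongr
        have := sum_geometric_two_le (J + 1)
        simpa using this
    _ = _ := by ring

end Peeling

/-! ### Uniform constants over the class and the rate. -/

section Rate

variable {E : Type*} [NormedAddCommGroup E] [NormedSpace ℝ E] [MeasurableSpace E]
  {lam : Measure E} {Ω : Set E} {L α C κ μmin : ℝ}

theorem InClass.mem_iff {f g : E → ℝ} (h : InClass lam Ω L α C κ μmin f g) {x : E} :
    x ∈ Ω ↔ 0 < f x + g x := by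
  rw [← h.support_eq]
  simp only [Set.mem_ofPred_eq, marginal]
  constructor <;> intro h <;> linarith

theorem InClass.integrable_marginal {f g : E → ℝ} (h : InClass lam Ω L α C κ μmin f g) :
    Integrable (marginal f g) lam :=
  (h.density_left.integrable.add h.density_right.integrable).div_const 2

theorem InClass.marginal_nonneg {f g : E → ℝ} (h : InClass lam Ω L α C κ μmin f g) (x : E) :
    0 ≤ marginal f g x :=
  div_nonneg (add_nonneg (h.density_left.nonneg x) (h.density_right.nonneg x)) zero_le_two

theorem InClass.integral_marginal {f g : E → ℝ} (h : InClass lam Ω L α C κ μmin f g) :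
    ∫ x, marginal f g x ∂lam = 1 := by
  unfold marginal
  rw [integral_div, integral_add h.density_left.integrable h.density_right.integrable,
    h.density_left.integral_eq_one, h.density_right.integral_eq_one]
  norm_num

/-- The minimal mass property holds with a constant and a range of radii that are common to the
whole class: a member of the class is bounded above on `Ω` by its minimal mass property, and hence
dominated by a multiple of any other member. -/
theorem exists_uniform_mass (hκ : 0 < κ) (hμmin : 0 < μmin) :
    ∃ c > 0, ∃ δ > 0, ∀ f g : E → ℝ, InClass lam Ω L α C κ μmin f g →
      ∀ r : ℝ, 0 < r → r ≤ δ → ∀ x ∈ Ω,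
        c * r ^ Module.finrank ℝ E ≤ ∫ z in Metric.ball x r, (f z + g z) ∂lam := by
  by_cases hne : ∃ f₀ g₀ : E → ℝ, InClass lam Ω L α C κ μmin f₀ g₀
  swap
  · exact ⟨1, one_pos, 1, one_pos, fun f g h => absurd ⟨f, g, h⟩ hne⟩
  -- The reference pair is chosen from the class alone, before `f` and `g`, so the constants built
  -- from it are uniform.
  obtain ⟨f₀, g₀, h₀⟩ := hne
  obtain ⟨δ, hδ, hmass⟩ := h₀.minimalMass
  set b := κ * δ ^ Module.finrank ℝ E with hb
  have hb0 : 0 < b := by positivity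
  have hbound : ∀ x ∈ Ω, b * marginal f₀ g₀ x ≤ 1 := by
    intro x hx
    calc b * marginal f₀ g₀ x = κ * marginal f₀ g₀ x * δ ^ Module.finrank ℝ E := by rw [hb]; ring
      _ ≤ ∫ z in Metric.ball x δ, marginal f₀ g₀ z ∂lam := hmass δ hδ le_rfl x hx
      _ ≤ ∫ z, marginal f₀ g₀ z ∂lam :=
          setIntegral_le_integral h₀.integrable_marginal (ae_of_all _ h₀.marginal_nonneg)
      _ = 1 := h₀.integral_marginal
  -- On `Ω` the reference marginal is at most `1 / b`, whereas `f + g ≥ 2 * μmin`; hence the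
  -- domination factor `2 * (μmin * b)`.
  refine ⟨2 * (μmin * b) * (κ * μmin), by positivity, δ, hδ, fun f g h r hr hrδ x hx => ?_⟩
  have hdom : ∀ z, 2 * (μmin * b) * marginal f₀ g₀ z ≤ f z + g z := by
    intro z
    by_cases hz : z ∈ Ω
    · have h1 := h.lower_bound z hz
      have h2 := mul_le_mul_of_nonneg_left (hbound z hz) hμmin.le
      unfold marginal at h1 h2 ⊢
      linarith
    · have h1 : ¬ 0 < marginal f₀ g₀ z := fun h' => hz (by rw [← h₀.support_eq]; exact h')
      have h2 : marginal f₀ g₀ z = 0 := le_antisymm (not_lt.1 h1) (h₀.marginal_nonneg z)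
      rw [h2, mul_zero]
      exact add_nonneg (h.density_left.nonneg z) (h.density_right.nonneg z)
  calc 2 * (μmin * b) * (κ * μmin) * r ^ Module.finrank ℝ E
      ≤ 2 * (μmin * b) * (κ * marginal f₀ g₀ x * r ^ Module.finrank ℝ E) := by
        rw [mul_assoc]
        gcongr
        exact h₀.lower_bound x hx
    _ ≤ 2 * (μmin * b) * ∫ z in Metric.ball x r, marginal f₀ g₀ z ∂lam := by
        gcongr
        exact hmass r hr hrδ x hx
    _ = ∫ z in Metric.ball x r, 2 * (μmin * b) * marginal f₀ g₀ z ∂lam :=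
        (integral_const_mul _ _).symm
    _ ≤ ∫ z in Metric.ball x r, (f z + g z) ∂lam :=
        setIntegral_mono (h₀.integrable_marginal.const_mul _).integrableOn
          (h.density_left.integrable.add h.density_right.integrable).integrableOn hdom

/-- Over the class, the excess risk is at most of order `n ^ (-(1 + α) / (2 + d))`. -/
theorem exists_excess_risk_le [FiniteDimensional ℝ E] [BorelSpace E] [lam.IsAddHaarMeasure]
    [Nontrivial E] (hα : 0 < α) (hκ : 0 < κ) (hμmin : 0 < μmin) :
    ∃ K : ℝ, 0 < K ∧ ∀ f g : E → ℝ, InClass lam Ω L α C κ μmin f g → ∀ n : ℕ, 2 ≤ n →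
      knnRisk lam f g n ⌊(n : ℝ) ^ (2 / (2 + Module.finrank ℝ E) : ℝ)⌋₊ -
        risk lam f g (bayes f g) ≤ K * (n : ℝ) ^ (-((1 + α) / (2 + Module.finrank ℝ E)) : ℝ) := by
  obtain ⟨c, hc, δ, hδ, hmass⟩ := exists_uniform_mass (lam := lam) (Ω := Ω) (L := L) (α := α)
    (C := C) (κ := κ) hκ hμmin
  set d := Module.finrank ℝ E with hd
  have hd0 : d ≠ 0 := Module.finrank_pos.ne'
  -- Chosen so that the ball of radius `A * η`, with `η = n ^ (-1 / (2 + d))`, has mass at least `η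
  -- ^ d`, which is at least `k / n`.
  set A : ℝ := c⁻¹ ^ ((d : ℝ)⁻¹) with hA
  have hA0 : 0 < A := by positivity
  have hAd : c * A ^ d = 1 := by
    rw [hA, Real.rpow_inv_natCast_pow (by positivity) hd0, mul_inv_cancel₀ hc.ne']
  -- For `D ≥ C₀ * η`, the first term gives `A * η ≤ δ` and the second makes the oscillation of the
  -- regression function on the ball at most `D / 2`.
  set C₀ : ℝ := A / δ + 2 * |L| * A + 1 with hC₀
  have hC₀1 : A / δ ≤ C₀ := by
    have : 0 ≤ 2 * |L| * A := by positivity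
    linarith
  have hC₀2 : 2 * |L| * A ≤ C₀ := by
    have : 0 ≤ A / δ := by positivity
    linarith
  have hC₀0 : 0 < C₀ := by positivity
  -- The constant is `512 = 2 * 256`, as rounding down to `k` costs at most a factor `2`.
  obtain ⟨B, hB1, hB⟩ := exists_exp_neg_sq_le_rpow (c := C₀ ^ 2 / 512) (a := α + 2) (by positivity)
  refine ⟨2 * ((|C| + 1) * B * 2 ^ (α + 2)) * C₀ ^ (1 + α), by positivity,
    fun f g h n hn => ?_⟩
  set y : ℝ := (n : ℝ) ^ (2 / (2 + d) : ℝ) with hy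
  set k := ⌊y⌋₊ with hk
  have hn1 : (1 : ℝ) ≤ n := by exact_mod_cast (by omega : 1 ≤ n)
  have hn0 : (0 : ℝ) < n := by linarith
  have hd2 : (0 : ℝ) < 2 + d := by positivity
  have hy1 : 1 ≤ y := Real.one_le_rpow hn1 (by positivity)
  have hk1 : 1 ≤ k := Nat.le_floor (by simpa using hy1)
  have hky : (k : ℝ) ≤ y := Nat.floor_le (by linarith)
  have hyk : y / 2 ≤ k := by
    have := Nat.lt_floor_add_one y
    have hk1' : (1 : ℝ) ≤ k := by exact_mod_cast hk1
    linarith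
  set η : ℝ := (n : ℝ) ^ (-(1 / (2 + d)) : ℝ) with hη
  have hη0 : 0 < η := Real.rpow_pos_of_pos hn0 _
  have hyη : y * η ^ 2 = 1 := by
    rw [hy, hη, ← Real.rpow_natCast, ← Real.rpow_mul hn0.le, ← Real.rpow_add hn0]
    rw [show (2 / (2 + d) + -(1 / (2 + d)) * (2 : ℕ) : ℝ) = 0 by push_cast; ring, Real.rpow_zero]
  have hyn : y / n = η ^ d := by
    rw [div_eq_iff hn0.ne', hy, hη, ← Real.rpow_natCast, ← Real.rpow_mul hn0.le,
      ← Real.rpow_add_one hn0.ne']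
    congr 1
    field_simp
    ring
  have hrate : (n : ℝ) ^ (-((1 + α) / (2 + d)) : ℝ) = η ^ (1 + α) := by
    rw [hη, ← Real.rpow_mul hn0.le]
    congr 1
    ring
  have hf := h.density_left
  have hg := h.density_right
  have hprob := isProbabilityMeasure_sampleLaw hf hg n
  have hkey : ∀ x, 0 < f x + g x → C₀ * η ≤ |regression f g x - 1 / 2| →
      (sampleLaw lam f g n).real {S | knnSDA k S x ≠ bayes f g x} ≤
        B * (|regression f g x - 1 / 2| / (C₀ * η)) ^ (-(α + 2)) := by
    intro x hx hDx
    set D := |regression f g x - 1 / 2| with hD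
    have hD1 : D ≤ 1 / 2 := abs_regression_sub_le hf.nonneg hg.nonneg x
    -- Small `n` needs no separate case: `C₀ * η ≤ D ≤ 1 / 2` already forces the radius into the
    -- admissible range.
    have hrδ : A * η ≤ δ := by
      have h1 : A / δ * η ≤ 1 := (mul_le_mul_of_nonneg_right hC₀1 hη0.le).trans (by linarith)
      rwa [div_mul_eq_mul_div, div_le_one hδ] at h1
    have hLr : |L| * (A * η) ≤ D / 2 := by
      have := mul_le_mul_of_nonneg_right hC₀2 hη0.le
      linarith
    have h1 := measureReal_knnSDA_ne_bayes_le hf hg (x := x) (r := A * η) (n := n) (k := k)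
      (by omega) hk1 (by positivity) hD (fun z hz hz0 => by
        refine (h.smooth x (h.mem_iff.2 hx) z (h.mem_iff.2 hz0)).trans (le_trans ?_ hLr)
        rw [Metric.mem_ball, dist_comm, dist_eq_norm] at hz
        exact mul_le_mul (le_abs_self L) hz.le (norm_nonneg _) (abs_nonneg _)) (by
        refine le_trans ?_ (hmass f g h (A * η) (by positivity) hrδ x (h.mem_iff.2 hx))
        rw [mul_pow, ← mul_assoc, hAd, one_mul, ← hyn]
        gcongr)
    refine h1.trans (le_trans ?_ (hB (D / (C₀ * η)) ((one_le_div (by positivity)).2 hDx)))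
    gcongr
    have h2 : C₀ ^ 2 / 512 * (D / (C₀ * η)) ^ 2 = y / 2 * D ^ 2 / 256 := by
      have : y = (η ^ 2)⁻¹ := eq_inv_of_mul_eq_one_left hyη
      rw [this]
      field_simp
      ring
    rw [h2]
    gcongr
  rw [knnRisk_sub_risk_bayes hf hg, hrate]
  have hpeel := integral_peeling_le (lam := lam) (m := fun x => f x + g x)
    (D := fun x => |regression f g x - 1 / 2|)
    (q := fun x => (sampleLaw lam f g n).real {S | knnSDA k S x ≠ bayes f g x})
    (C := C) (ε := C₀ * η) hα hB1 (by positivity) (hf.integrable.add hg.integrable)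
    (fun x => add_nonneg (hf.nonneg x) (hg.nonneg x))
    ((measurable_regression hf.measurable hg.measurable).sub_const _).abs
    (fun x => abs_nonneg _)
    (fun x => (abs_regression_sub_le hf.nonneg hg.nonneg x).trans (by norm_num))
    h.margin (fun x => measureReal_le_one) hkey (integrable_excess_mul hf hg n k)
  refine hpeel.trans ?_
  rw [Real.mul_rpow hC₀0.le hη0.le, ← mul_assoc]
  gcongr
  linarith [le_abs_self C]

end Rate

end SmoothDA

end

/-! ### The two stated bounds, from the rate without logarithm. -/

theorem mainTheorem7 {E : Type*} [NormedAddCommGroup E] [NormedSpace ℝ E] [FiniteDimensional ℝ E]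
    [MeasurableSpace E] [BorelSpace E] (lam : Measure E) [lam.IsAddHaarMeasure]
    (d : ℕ) (hd : Module.finrank ℝ E = d) (hd_pos : 1 ≤ d)
    (Ω : Set E) (L α C κ μmin : ℝ) (hα : 0 < α) (hκ : 0 < κ) (hμmin : 0 < μmin) :
    ∃ K : ℝ, 0 < K ∧ ∀ f g : E → ℝ, SmoothDA.InClass lam Ω L α C κ μmin f g →
      ∀ n : ℕ, 2 ≤ n → ∀ k : ℕ, k = ⌊(n : ℝ) ^ (2 / (2 + d) : ℝ)⌋₊ →
        Integrable (fun S => SmoothDA.risk lam f g (SmoothDA.knnSDA k S))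
            (SmoothDA.sampleLaw lam f g n) ∧
        SmoothDA.knnRisk lam f g n k - SmoothDA.risk lam f g (SmoothDA.bayes f g) ≤
            K * (Real.log n * (n : ℝ) ^ (-((1 + α) / (2 + d)) : ℝ)) ∧
        SmoothDA.knnRisk lam f g n k - SmoothDA.risk lam f g (SmoothDA.bayes f g) ≤
            K * (Real.log n / n) ^ ((1 + α) / (2 + d) : ℝ) := by
  subst hd
  have : Nontrivial E := Module.finrank_pos_iff.1 hd_pos
  obtain ⟨K, hK, hrate⟩ := SmoothDA.exists_excess_risk_le (lam := lam) (Ω := Ω) (L := L) (C := C)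
    hα hκ hμmin
  set d := Module.finrank ℝ E
  set β : ℝ := (1 + α) / (2 + d) with hβ
  have hβ0 : 0 < β := by positivity
  have hl2 : 0 < Real.log 2 := Real.log_pos (by norm_num)
  -- As `n ≥ 2`, `log n` is at least `log 2`, so either logarithmic factor can be inserted at the
  -- price of a constant; one summand serves each bound.
  refine ⟨K / Real.log 2 + K / Real.log 2 ^ β, by positivity, fun f g h n hn k hk => ?_⟩
  subst hk
  have hn0 : (0 : ℝ) < n := by exact_mod_cast (by omega : 0 < n)
  have hln : Real.log 2 ≤ Real.log n := Real.log_le_log (by norm_num) (by exact_mod_cast hn)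
  have hln0 : 0 < Real.log n := hl2.trans_le hln
  have hR := hrate f g h n hn
  refine ⟨SmoothDA.integrable_risk_knnSDA h.density_left h.density_right n _, hR.trans ?_,
    hR.trans ?_⟩
  · calc K * (n : ℝ) ^ (-β) = K / Real.log 2 * (Real.log 2 * (n : ℝ) ^ (-β)) := by field_simp
      _ ≤ (K / Real.log 2 + K / Real.log 2 ^ β) * (Real.log n * (n : ℝ) ^ (-β)) := by
          gcongr
          exact le_add_of_nonneg_right (by positivity)
  · rw [Real.div_rpow hln0.le hn0.le]
    calc K * (n : ℝ) ^ (-β) = K / Real.log 2 ^ β * (Real.log 2 ^ β / (n : ℝ) ^ β) := by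
          rw [Real.rpow_neg hn0.le]; field_simp
      _ ≤ (K / Real.log 2 + K / Real.log 2 ^ β) * (Real.log n ^ β / (n : ℝ) ^ β) := by
          gcongr
          exact le_add_of_nonneg_left (by positivity)
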